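/- **Theorem (Almost sure convergence rates).** Let $\|\cdot\|$ be any norm on $\mathbb{R}^d$, and let $\mathcal{Y}$ be a measurable space. *Noise.* Let $P$ be a Markov transition kernel on $\mathcal{Y}$ with $n$-step kernels $P^n$ and a unique stationary distribution $d_{\mathcal{Y}}$, and assume that there are constants $\varrho\in[0,1)$ and $C$ such that for all $y\in\mathcal{Y}$ and $n\ge 0$, in total variation norm (total mass of the variation), $$\int_{\mathcal{Y}}\bigl|P^n(y,\mathrm{d}y')-d_{\mathcal{Y}}(\mathrm{d}y')\bigr|\le C\varrho^n .$$ Let $(Y_t)_{t\ge0}$ be a Markov chain with transition kernel $P$ with respect to a filtration $(\mathcal{F}_t)_{t\ge 0}$ on a probability space, i.e. $Y_t$ is $\mathcal{F}_t$-measurable and $\mathbb{P}(Y_{t+1}\in B\mid\mathcal{F}_t)=P(Y_t,B)$ almost surely for all $t\ge0$ and measurable $B$. *Update function.* Let $H:\mathbb{R}^d\times\mathcal{Y}\to\mathbb{R}^d$ be measurable in its second argument and suppose that there is a finite $L_h$ with $\|H(w,y)-H(w',y)\|\le L_h\|w-w'\|$ for all $w,w',y$, and that $\sup_{y}\|H(0,y)\|<\infty$.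 Put $h(w)=\mathbb{E}_{y\sim d_{\mathcal{Y}}}[H(w,y)]$ and suppose that there is $\kappa\in[0,1)$ with $\|h(w)-h(w')\|\le\kappa\|w-w'\|$ for all $w,w'$. *Iterates.* Let $\alpha_t=\dfrac{C_\alpha}{(t+3)^\nu}$ with $C_\alpha>0$ and $\nu\in(2/3,1]$, let $w_0$ be an $\mathcal{F}_0$-measurable random vector in $\mathbb{R}^d$ (for instance a deterministic one), and let $$w_{t+1}=w_t+\alpha_t\bigl(H(w_t,Y_{t+1})-w_t\bigr),\qquad t\ge0 .$$ Then $h$ has a unique fixed point $w_*$, and the following hold. * If $\nu<1$, then for every $\zeta\in(0,\tfrac32\nu-1)$, $\displaystyle\lim_{t\to\infty}t^{\zeta}\|w_t-w_*\|^2=0$ almost surely. * If $\nu=1$, then for every $\zeta\in(0,1)$ and every $\nu_1>0$, $\displaystyle\lim_{t\to\infty}\exp\bigl(\zeta(\ln t)^{1/(1+\nu_1)}\bigr)\|w_t-w_*\|^2=0$ almost surely. -/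

import Mathlib

open MeasureTheory ProbabilityTheory Filter Topology
open scoped ENNReal

/-- The powers `P ^ n` (composition of kernels) of a Markov kernel are Markov kernels; `P ^ n` is
the `n`-step transition kernel. -/
instance isMarkovKernel_pow {𝒴 : Type*} [MeasurableSpace 𝒴] (P : Kernel 𝒴 𝒴) [IsMarkovKernel P]
    (n : ℕ) : IsMarkovKernel (P ^ n) := by
  induction n with
  | zero =>
    rw [pow_zero]
    exact inferInstanceAs (IsMarkovKernel (Kernel.id : Kernel 𝒴 𝒴))
  | succ k ih =>
    rw [pow_succ]
    exact inferInstanceAs (IsMarkovKernel ((P ^ k) ∘ₖ P))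

/-- The total variation norm `∫ |dμ - dν|` of the difference of two finite measures
(equal to `∫ |p - q| dλ` when `μ` and `ν` have densities `p` and `q` with respect to `λ`). -/
noncomputable def tvNorm {𝒴 : Type*} [MeasurableSpace 𝒴] (μ ν : Measure 𝒴)
    [IsFiniteMeasure μ] [IsFiniteMeasure ν] : ℝ :=
  (μ.toSignedMeasure - ν.toSignedMeasure).totalVariation.real Set.univ

/-- The transition kernel `P` has `d` as its unique stationary distribution, and the `n`-step
transition probabilities converge to `d` geometrically fast in total variation, uniformly in the
starting point. -/
structure GeometricallyMixing {𝒴 : Type*} [MeasurableSpace 𝒴] (P : Kernel 𝒴 𝒴)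
    [IsMarkovKernel P] (d : Measure 𝒴) [IsProbabilityMeasure d] : Prop where
  invariant : P.Invariant d
  unique : ∀ d' : Measure 𝒴, IsProbabilityMeasure d' → P.Invariant d' → d' = d
  mixing : ∃ ρ : ℝ, 0 ≤ ρ ∧ ρ < 1 ∧ ∃ C : ℝ, ∀ (y : 𝒴) (n : ℕ), tvNorm ((P ^ n) y) d ≤ C * ρ ^ n

/-- `Y` is a time-homogeneous Markov chain with transition kernel `P` with respect to the
filtration `𝓕`: `Y` is adapted, and given `𝓕 t` the conditional law of `Y (t + 1)` is
`P (Y t, ·)`. -/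
structure IsMarkovChain {Ω 𝒴 : Type*} {mΩ : MeasurableSpace Ω} [MeasurableSpace 𝒴]
    (P : Kernel 𝒴 𝒴) (𝓕 : Filtration ℕ mΩ) (Y : ℕ → Ω → 𝒴) (μ : Measure Ω) : Prop where
  adapted : ∀ t, Measurable[𝓕 t] (Y t)
  markov : ∀ (t : ℕ) (B : Set 𝒴), MeasurableSet B →
    μ[(Y (t + 1) ⁻¹' B).indicator (fun _ ↦ (1 : ℝ)) | 𝓕 t] =ᵐ[μ] fun ω ↦ (P (Y t ω)).real B

/-- The averaged operator `h w = 𝔼_{y ∼ d} [H (w, y)]`. -/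
noncomputable def meanOperator {E 𝒴 : Type*} [NormedAddCommGroup E] [NormedSpace ℝ E]
    [MeasurableSpace 𝒴] (H : E → 𝒴 → E) (d : Measure 𝒴) (w : E) : E :=
  ∫ y, H w y ∂d

/-! The noise is split by the Poisson equation. If `q` is the `poissonSeries` of `f`, then
`f(Y_{k+1}) - d f` is a martingale difference plus `q(Y_k) - q(Y_{k+1})`, and the latter telescopes
up to the drift of the iterate. No a priori bound on the iterates is available, so the noise is
first divided by their running maximum `G`; it is then bounded, and its series against any
decreasing square-summable weights `β ≥ α` tending to `0` converges almost surely
(`ae_exists_tendsto_sum_smul_noise`).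

Factor `α = γ β` with `γ t = (t + 3)^(-a)`; square-summability of `β` is the condition `a < ν -
1/2`. If `R` denotes the tails of the convergent series, the recursion becomes deterministic on each
path: a contraction step plus `g t • (R t - R (t + 1))`, where `g = γ G` and `R → 0`. Adding `g t •
R t` to the iterate absorbs the noise. One pass shows that `G` is bounded (`exists_runningMax_le`),
so that `g = O(γ)`; a second gives the error bound `O(γ)` (`exists_eventually_norm_sub_le`).

The squared error is thus `O(t^(-2a))`. For `ν < 1` every `a < ν - 1/2` is allowed, and `3ν/2 - 1 <
2ν - 1`. For `ν = 1` some `a > 0` suffices, since a power of `t` dominates `exp(ζ (ln t)^θ)` when `θ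
< 1`. -/

/-! ### Total variation -/

/-- Integrals of a bounded function against two measures differ by at most the bound times the
total variation norm. -/
lemma abs_integral_sub_integral_le_tvNorm {𝒴 : Type*} [MeasurableSpace 𝒴] (μ ν : Measure 𝒴)
    [IsFiniteMeasure μ] [IsFiniteMeasure ν] {f : 𝒴 → ℝ} (hf : Measurable f) {B : ℝ}
    (hB : ∀ y, |f y| ≤ B) : |∫ y, f y ∂μ - ∫ y, f y ∂ν| ≤ B * tvNorm μ ν := by
  set j := (μ.toSignedMeasure - ν.toSignedMeasure).toJordanDecomposition with hj
  have hjs : j.posPart.toSignedMeasure - j.negPart.toSignedMeasure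
      = μ.toSignedMeasure - ν.toSignedMeasure :=
    SignedMeasure.toSignedMeasure_toJordanDecomposition _
  have hint : ∀ (m : Measure 𝒴) [IsFiniteMeasure m], Integrable f m := fun m _ ↦
    Integrable.of_bound hf.aestronglyMeasurable B (ae_of_all _ hB)
  -- Moving the negative parts across leaves an identity between positive measures, against which
  -- `f` can be integrated.
  have hadd : μ + j.negPart = ν + j.posPart := by
    rw [← Measure.toSignedMeasure_eq_toSignedMeasure_iff, Measure.toSignedMeasure_add,
      Measure.toSignedMeasure_add]
    rw [sub_eq_sub_iff_add_eq_add] at hjs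
    rw [add_comm ν.toSignedMeasure, hjs]
  have hval : ∫ y, f y ∂μ - ∫ y, f y ∂ν = ∫ y, f y ∂j.posPart - ∫ y, f y ∂j.negPart := by
    have h := congrArg (fun m : Measure 𝒴 ↦ ∫ y, f y ∂m) hadd
    simp only [integral_add_measure (hint _) (hint _)] at h
    linarith
  have hle : ∀ (m : Measure 𝒴) [IsFiniteMeasure m], |∫ y, f y ∂m| ≤ B * m.real Set.univ :=
    fun m _ ↦ by
    simpa using norm_integral_le_of_norm_le_const (μ := m) (f := f) (C := B) (ae_of_all _ hB)
  have htv : tvNorm μ ν = j.posPart.real Set.univ + j.negPart.real Set.univ := by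
    rw [tvNorm, SignedMeasure.totalVariation, measureReal_add_apply]
  rw [hval, htv, mul_add]
  exact (abs_sub _ _).trans (add_le_add (hle _) (hle _))

/-! ### The Poisson equation of a geometrically mixing kernel -/

section Poisson

variable {𝒴 : Type*} [MeasurableSpace 𝒴] (P : Kernel 𝒴 𝒴) (d : Measure 𝒴)

/-- The series `∑ n, (P ^ (n + 1) f - d f)`; adding `f - d f` gives a solution of the Poisson
equation for `f`. -/
noncomputable def poissonSeries (f : 𝒴 → ℝ) (y : 𝒴) : ℝ :=
  ∑' n : ℕ, (∫ z, f z ∂((P ^ (n + 1)) y) - ∫ z, f z ∂d)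

variable {P d} [IsMarkovKernel P] [IsProbabilityMeasure d]

/-- Uniform geometric decay of the terms of `poissonSeries`. -/
lemma GeometricallyMixing.exists_geometric_bound (hP : GeometricallyMixing P d) :
    ∃ ρ C : ℝ, 0 ≤ ρ ∧ ρ < 1 ∧ 0 ≤ C ∧ ∀ (f : 𝒴 → ℝ) (B : ℝ), Measurable f → (∀ y, |f y| ≤ B) →
      ∀ y n, |∫ z, f z ∂((P ^ n) y) - ∫ z, f z ∂d| ≤ B * C * ρ ^ n := by
  obtain ⟨ρ, h0, h1, C, hC⟩ := hP.mixing
  refine ⟨ρ, max C 0, h0, h1, le_max_right _ _, fun f B hf hB y n ↦ ?_⟩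
  have hB0 : 0 ≤ B := (abs_nonneg _).trans (hB y)
  refine (abs_integral_sub_integral_le_tvNorm _ _ hf hB).trans ?_
  rw [mul_assoc]
  gcongr
  exact (hC y n).trans (by gcongr; exact le_max_left _ _)

lemma GeometricallyMixing.summable_poissonSeries (hP : GeometricallyMixing P d) {f : 𝒴 → ℝ} {B : ℝ}
    (hf : Measurable f) (hB : ∀ y, |f y| ≤ B) (y : 𝒴) :
    Summable fun n : ℕ ↦ ∫ z, f z ∂((P ^ (n + 1)) y) - ∫ z, f z ∂d := by
  obtain ⟨ρ, C, h0, h1, -, h⟩ := hP.exists_geometric_bound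
  refine Summable.of_norm_bounded (g := fun n ↦ B * C * ρ ^ (n + 1)) ?_
    fun n ↦ h f B hf hB y (n + 1)
  exact ((summable_nat_add_iff 1).2 (summable_geometric_of_lt_one h0 h1)).mul_left _

lemma GeometricallyMixing.exists_abs_poissonSeries_le (hP : GeometricallyMixing P d) :
    ∃ K : ℝ, 0 ≤ K ∧ ∀ (f : 𝒴 → ℝ) (B : ℝ), Measurable f → (∀ y, |f y| ≤ B) →
      ∀ y, |poissonSeries P d f y| ≤ B * K := by
  obtain ⟨ρ, C, h0, h1, hC, h⟩ := hP.exists_geometric_bound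
  have hs : HasSum (fun n : ℕ ↦ ρ ^ n) (1 - ρ)⁻¹ := hasSum_geometric_of_lt_one h0 h1
  refine ⟨C * ρ * (1 - ρ)⁻¹, by have := sub_pos.2 h1; positivity, fun f B hf hB y ↦ ?_⟩
  have := tsum_of_norm_bounded (hs.mul_left (B * C * ρ)) (f := fun n : ℕ ↦
    ∫ z, f z ∂((P ^ (n + 1)) y) - ∫ z, f z ∂d) fun n ↦ (h f B hf hB y (n + 1)).trans
      (by rw [pow_succ]; apply le_of_eq; ring)
  refine this.trans (le_of_eq ?_)
  ring

/-- Linearity, combined with the sup bound, makes the Poisson solution inherit the Lipschitz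
dependence of `f` on a parameter. -/
lemma GeometricallyMixing.poissonSeries_sub (hP : GeometricallyMixing P d) {f g : 𝒴 → ℝ} {B B' : ℝ}
    (hf : Measurable f) (hB : ∀ y, |f y| ≤ B) (hg : Measurable g) (hB' : ∀ y, |g y| ≤ B') (y : 𝒴) :
    poissonSeries P d (fun z ↦ f z - g z) y = poissonSeries P d f y - poissonSeries P d g y := by
  have hi : ∀ (m : Measure 𝒴) [IsFiniteMeasure m], Integrable f m := fun m _ ↦
    Integrable.of_bound hf.aestronglyMeasurable B (ae_of_all _ hB)
  have hi' : ∀ (m : Measure 𝒴) [IsFiniteMeasure m], Integrable g m := fun m _ ↦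
    Integrable.of_bound hg.aestronglyMeasurable B' (ae_of_all _ hB')
  rw [poissonSeries, poissonSeries, poissonSeries,
    ← (hP.summable_poissonSeries hf hB y).tsum_sub (hP.summable_poissonSeries hg hB' y)]
  congr with n
  rw [integral_sub (hi _) (hi' _), integral_sub (hi _) (hi' _)]
  ring

lemma GeometricallyMixing.measurable_poissonSeries (hP : GeometricallyMixing P d) {f : 𝒴 → ℝ}
    {B : ℝ} (hf : Measurable f) (hB : ∀ y, |f y| ≤ B) : Measurable (poissonSeries P d f) := by
  refine measurable_of_tendsto_metrizable (f := fun N y ↦ ∑ n ∈ Finset.range N,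
    (∫ z, f z ∂((P ^ (n + 1)) y) - ∫ z, f z ∂d)) (fun N ↦ ?_) ?_
  · refine Finset.measurable_sum _ fun n _ ↦ ?_
    exact (hf.stronglyMeasurable.integral_kernel (κ := P ^ (n + 1))).measurable.sub_const _
  · exact tendsto_pi_nhds.2 fun y ↦ (hP.summable_poissonSeries hf hB y).hasSum.tendsto_sum_nat

/-- The Poisson equation. -/
lemma GeometricallyMixing.integral_add_poissonSeries (hP : GeometricallyMixing P d) {f : 𝒴 → ℝ}
    {B : ℝ} (hf : Measurable f) (hB : ∀ y, |f y| ≤ B) (y : 𝒴) :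
    ∫ z, (f z - ∫ x, f x ∂d + poissonSeries P d f z) ∂(P y) = poissonSeries P d f y := by
  have hi : ∀ (m : Measure 𝒴) [IsFiniteMeasure m], Integrable f m := fun m _ ↦
    Integrable.of_bound hf.aestronglyMeasurable B (ae_of_all _ hB)
  obtain ⟨ρ, C, h0, h1, hC, h⟩ := hP.exists_geometric_bound
  obtain ⟨K, hK, hKb⟩ := hP.exists_abs_poissonSeries_le
  have hq : Integrable (poissonSeries P d f) (P y) :=
    Integrable.of_bound (hP.measurable_poissonSeries hf hB).aestronglyMeasurable (B * K)
      (ae_of_all _ (hKb f B hf hB))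
  -- Chapman–Kolmogorov: integrating against `P y` shifts the index by one. Summed over `n`, this
  -- leaves only the first term of the series at `y`, which `f - d f` supplies.
  have hterm : ∀ n : ℕ, ∫ z, (∫ x, f x ∂((P ^ (n + 1)) z) - ∫ x, f x ∂d) ∂(P y)
      = ∫ x, f x ∂((P ^ (n + 1 + 1)) y) - ∫ x, f x ∂d := by
    intro n
    have hP' : P ^ (n + 1 + 1) = (P ^ (n + 1)) ∘ₖ P := pow_succ P (n + 1)
    have hi2 : Integrable f (((P ^ (n + 1)) ∘ₖ P) y) := hi _
    rw [integral_sub hi2.integral_comp (integrable_const _), hP', Kernel.integral_comp hi2]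
    simp
  have hmeas : ∀ n : ℕ, Measurable fun z ↦ ∫ x, f x ∂((P ^ (n + 1)) z) - ∫ x, f x ∂d := fun n ↦
    (hf.stronglyMeasurable.integral_kernel (κ := P ^ (n + 1))).measurable.sub_const _
  have hsum : HasSum (fun n : ℕ ↦ ∫ x, f x ∂((P ^ (n + 1 + 1)) y) - ∫ x, f x ∂d)
      (∫ z, poissonSeries P d f z ∂(P y)) := by
    simp_rw [← hterm]
    refine hasSum_integral_of_dominated_convergence (fun n _ ↦ B * C * ρ ^ (n + 1))
      (fun n ↦ (hmeas n).aestronglyMeasurable) (fun n ↦ ae_of_all _ fun z ↦ h f B hf hB z (n + 1))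
      (ae_of_all _ fun z ↦ ?_) (integrable_const _)
      (ae_of_all _ fun z ↦ (hP.summable_poissonSeries hf hB z).hasSum)
    exact ((summable_nat_add_iff 1).2 (summable_geometric_of_lt_one h0 h1)).mul_left _
  have hsub : Integrable (fun z ↦ f z - ∫ x, f x ∂d) (P y) := (hi _).sub (integrable_const _)
  rw [integral_add hsub hq, integral_sub (hi _) (integrable_const _),
    ← hsum.tsum_eq, poissonSeries, (hP.summable_poissonSeries hf hB y).tsum_eq_zero_add]
  simp

end Poisson

/-! ### Conditioning on the past of the chain -/

section MarkovChain

variable {Ω 𝒴 : Type*} {mΩ : MeasurableSpace Ω} [MeasurableSpace 𝒴] {P : Kernel 𝒴 𝒴}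
  [IsMarkovKernel P] {𝓕 : Filtration ℕ mΩ} {Y : ℕ → Ω → 𝒴} {μ : Measure Ω} [IsProbabilityMeasure μ]

/-- Rectangles determine a finite measure, and on `s ×ˢ B` the identity is the Markov property
integrated over the past event `A`. The variable `U` carries arbitrary past data, and `𝒴` need not
be standard Borel. -/
lemma IsMarkovChain.map_prodMk_eq_compProd (hY : IsMarkovChain P 𝓕 Y μ) (t : ℕ) {S : Type*}
    [MeasurableSpace S] {U : Ω → S} (hU : Measurable[𝓕 t] U) :
    μ.map (fun ω ↦ ((U ω, Y t ω), Y (t + 1) ω))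
      = (μ.map fun ω ↦ (U ω, Y t ω)) ⊗ₘ (Kernel.prodMkLeft S P) := by
  have hUY : Measurable[𝓕 t] fun ω ↦ (U ω, Y t ω) := hU.prodMk (hY.adapted t)
  have hUY' : Measurable fun ω ↦ (U ω, Y t ω) := hUY.mono (𝓕.le t) le_rfl
  have hY1 : Measurable (Y (t + 1)) := (hY.adapted (t + 1)).mono (𝓕.le _) le_rfl
  have hY0 : Measurable (Y t) := (hY.adapted t).mono (𝓕.le _) le_rfl
  have : IsProbabilityMeasure (μ.map fun ω ↦ ((U ω, Y t ω), Y (t + 1) ω)) :=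
    Measure.isProbabilityMeasure_map (hUY'.prodMk hY1).aemeasurable
  refine Measure.ext_prod fun {s B} hs hB ↦ ?_
  rw [Measure.map_apply (hUY'.prodMk hY1) (hs.prod hB), Measure.compProd_apply_prod hs hB,
    setLIntegral_map hs (Kernel.measurable_coe _ hB) hUY']
  set A := (fun ω ↦ (U ω, Y t ω)) ⁻¹' s with hA
  have hAm : MeasurableSet[𝓕 t] A := hUY hs
  have hBm : MeasurableSet (Y (t + 1) ⁻¹' B) := hY1 hB
  have hint : Integrable ((Y (t + 1) ⁻¹' B).indicator fun _ ↦ (1 : ℝ)) μ :=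
    (integrable_const 1).indicator hBm
  have h1 := setIntegral_condExp (𝓕.le t) hint hAm
  rw [setIntegral_congr_ae (g := fun ω ↦ (P (Y t ω)).real B) (𝓕.le t _ hAm)
    ((hY.markov t B hB).mono fun ω h _ ↦ h), integral_indicator_const _ hBm] at h1
  simp only [smul_eq_mul, mul_one, Measure.real] at h1
  rw [integral_toReal (f := fun ω ↦ P (Y t ω) B) ((Kernel.measurable_coe P hB).comp hY0).aemeasurable
    (ae_of_all _ fun ω ↦ measure_lt_top _ _), Measure.restrict_apply hBm] at h1
  have hfin : ∫⁻ ω in A, P (Y t ω) B ∂μ ≠ ∞ := by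
    refine ne_top_of_le_ne_top (b := ∫⁻ ω in A, 1 ∂μ) (by simp) (lintegral_mono fun ω ↦ prob_le_one)
  have h2 := (ENNReal.toReal_eq_toReal_iff' hfin (measure_ne_top _ _)).1 h1
  simp only [Kernel.prodMkLeft_apply]
  rw [h2]
  congr 1
  ext ω
  simp [hA, and_comm]

/-- The freezing lemma for a Markov chain. -/
lemma IsMarkovChain.integral_eq (hY : IsMarkovChain P 𝓕 Y μ) (t : ℕ) {S : Type*}
    [MeasurableSpace S] {U : Ω → S} (hU : Measurable[𝓕 t] U) {F : (S × 𝒴) × 𝒴 → ℝ}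
    (hF : Measurable F) {C : ℝ} (hC : ∀ ω, |F ((U ω, Y t ω), Y (t + 1) ω)| ≤ C) :
    ∫ ω, F ((U ω, Y t ω), Y (t + 1) ω) ∂μ = ∫ ω, ∫ y, F ((U ω, Y t ω), y) ∂(P (Y t ω)) ∂μ := by
  have hUY' : Measurable fun ω ↦ (U ω, Y t ω) :=
    (hU.prodMk (hY.adapted t)).mono (𝓕.le t) le_rfl
  have hY1 : Measurable (Y (t + 1)) := (hY.adapted (t + 1)).mono (𝓕.le _) le_rfl
  have hX := hUY'.prodMk hY1
  have hint : Integrable F (μ.map fun ω ↦ ((U ω, Y t ω), Y (t + 1) ω)) :=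
    (integrable_map_measure hF.aestronglyMeasurable hX.aemeasurable).2
      (Integrable.of_bound (hF.comp hX).aestronglyMeasurable C (ae_of_all _ hC))
  have h1 := integral_map (μ := μ) hX.aemeasurable (f := F) hF.aestronglyMeasurable
  rw [hY.map_prodMk_eq_compProd t hU] at h1 hint
  rw [← h1, Measure.integral_compProd hint, integral_map hUY'.aemeasurable]
  · simp
  · exact (hF.stronglyMeasurable.integral_kernel_prod_right'
      (κ := Kernel.prodMkLeft S P)).aestronglyMeasurable

end MarkovChain

/-! ### Convergence of martingale series -/

/-- A series of bounded martingale differences with square-summable weights converges almost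
surely. -/
lemma ae_exists_tendsto_sum_of_martingale_difference {Ω : Type*} {mΩ : MeasurableSpace Ω}
    {μ : Measure Ω} [IsProbabilityMeasure μ] {𝓕 : Filtration ℕ mΩ} {D : ℕ → Ω → ℝ} {C : ℝ}
    (hD_meas : ∀ n, Measurable[𝓕 (n + 1)] (D n)) (hD_bdd : ∀ n ω, |D n ω| ≤ C)
    (hD_orth : ∀ n (c : Ω → ℝ), Measurable[𝓕 n] c → (∃ K, ∀ ω, |c ω| ≤ K) →
      ∫ ω, c ω * D n ω ∂μ = 0)
    {β : ℕ → ℝ} (hβ : Summable fun n ↦ β n ^ 2) :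
    ∀ᵐ ω ∂μ, ∃ l, Tendsto (fun n ↦ ∑ k ∈ Finset.range n, β k * D k ω) atTop (𝓝 l) := by
  set M : ℕ → Ω → ℝ := fun n ω ↦ ∑ k ∈ Finset.range n, β k * D k ω with hM
  have hM_meas : ∀ n, Measurable[𝓕 n] (M n) := fun n ↦
    Finset.measurable_sum _ fun k hk ↦ Measurable.const_mul
      ((hD_meas k).mono (𝓕.mono (Finset.mem_range.1 hk)) le_rfl) _
  have hM_bdd : ∀ n, ∃ K, ∀ ω, |M n ω| ≤ K := fun n ↦
    ⟨∑ k ∈ Finset.range n, |β k| * C, fun ω ↦ (Finset.abs_sum_le_sum_abs _ _).trans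
      (Finset.sum_le_sum fun k _ ↦ by rw [abs_mul]; gcongr; exact hD_bdd k ω)⟩
  have hM_meas' : ∀ n, Measurable (M n) := fun n ↦ (hM_meas n).mono (𝓕.le n) le_rfl
  have hD_meas' : ∀ n, Measurable (D n) := fun n ↦ (hD_meas n).mono (𝓕.le _) le_rfl
  have hM_int : ∀ n, Integrable (M n) μ := fun n ↦
    let ⟨K, hK⟩ := hM_bdd n
    Integrable.of_bound (hM_meas' n).aestronglyMeasurable K (ae_of_all _ hK)
  have hD_int : ∀ n, Integrable (D n) μ := fun n ↦
    Integrable.of_bound (hD_meas' n).aestronglyMeasurable C (ae_of_all _ (hD_bdd n))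
  have hM_succ : ∀ n ω, M (n + 1) ω = M n ω + β n * D n ω := fun n ω ↦
    Finset.sum_range_succ _ _
  have hmart : Martingale M 𝓕 μ := by
    refine martingale_of_setIntegral_eq_succ (fun n ↦ (hM_meas n).stronglyMeasurable) hM_int ?_
    intro n s hs
    simp_rw [hM_succ]
    rw [integral_add (hM_int n).integrableOn ((hD_int n).const_mul _).integrableOn,
      integral_const_mul]
    -- Testing against indicators of past events gives the martingale property; testing against `M
    -- n` itself will give the orthogonality of increments behind `hsq`.
    have h0 := hD_orth n (s.indicator fun _ ↦ 1) (measurable_const.indicator hs)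
      ⟨1, fun ω ↦ by by_cases h : ω ∈ s <;> simp [h]⟩
    have h1 : ∀ ω, s.indicator (fun _ ↦ (1 : ℝ)) ω * D n ω = s.indicator (D n) ω := fun ω ↦ by
      by_cases h : ω ∈ s <;> simp [h]
    simp_rw [h1] at h0
    rw [integral_indicator (𝓕.le n _ hs)] at h0
    rw [h0, mul_zero, add_zero]
  have hsq_int : ∀ n, Integrable (fun ω ↦ M n ω ^ 2) μ := fun n ↦ by
    obtain ⟨K, hK⟩ := hM_bdd n
    refine Integrable.of_bound ((hM_meas' n).pow_const 2).aestronglyMeasurable (K ^ 2)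
      (ae_of_all _ fun ω ↦ ?_)
    rw [norm_pow]
    exact pow_le_pow_left₀ (abs_nonneg _) (hK ω) 2
  have hDsq_le : ∀ n ω, D n ω ^ 2 ≤ C ^ 2 := fun n ω ↦ by
    rw [← sq_abs]
    exact pow_le_pow_left₀ (abs_nonneg _) (hD_bdd n ω) 2
  have hDsq_int : ∀ n, Integrable (fun ω ↦ D n ω ^ 2) μ := fun n ↦ by
    refine Integrable.of_bound ((hD_meas' n).pow_const 2).aestronglyMeasurable (C ^ 2)
      (ae_of_all _ fun ω ↦ ?_)
    rw [Real.norm_of_nonneg (sq_nonneg _)]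
    exact hDsq_le n ω
  have hMD_int : ∀ n, Integrable (fun ω ↦ M n ω * D n ω) μ := fun n ↦ by
    obtain ⟨K, hK⟩ := hM_bdd n
    exact (hD_int n).bdd_mul (hM_meas' n).aestronglyMeasurable (c := K) (ae_of_all _ hK)
  have hsq : ∀ n, ∫ ω, M n ω ^ 2 ∂μ ≤ C ^ 2 * ∑ k ∈ Finset.range n, β k ^ 2 := by
    intro n
    induction n with
    | zero => simp [hM]
    | succ n ih =>
      have h1 : ∀ ω, M (n + 1) ω ^ 2
          = M n ω ^ 2 + (2 * β n * (M n ω * D n ω) + β n ^ 2 * D n ω ^ 2) := fun ω ↦ by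
        rw [hM_succ]; ring
      simp_rw [h1]
      have hint1 : Integrable (fun ω ↦ 2 * β n * (M n ω * D n ω) + β n ^ 2 * D n ω ^ 2) μ :=
        ((hMD_int n).const_mul _).add ((hDsq_int n).const_mul _)
      rw [integral_add (hsq_int n) hint1,
        integral_add ((hMD_int n).const_mul _) ((hDsq_int n).const_mul _), integral_const_mul,
        integral_const_mul, hD_orth n _ (hM_meas n) (hM_bdd n), Finset.sum_range_succ]
      have h2 : ∫ ω, D n ω ^ 2 ∂μ ≤ C ^ 2 := by
        refine (integral_mono (hDsq_int n) (integrable_const (C ^ 2)) (hDsq_le n)).trans ?_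
        simp
      nlinarith [mul_le_mul_of_nonneg_left h2 (sq_nonneg (β n))]
  set R : ℝ := 1 + C ^ 2 * ∑' k, β k ^ 2 with hR
  refine hmart.submartingale.exists_ae_tendsto_of_bdd (R := R.toNNReal) fun n ↦ ?_
  rw [eLpNorm_one_eq_lintegral_enorm, ← ofReal_integral_norm_eq_lintegral_enorm (hM_int n)]
  refine ENNReal.ofReal_le_ofReal ?_
  calc ∫ ω, ‖M n ω‖ ∂μ ≤ ∫ ω, (1 + M n ω ^ 2) ∂μ := by
        refine integral_mono (hM_int n).norm ((integrable_const 1).add (hsq_int n)) fun ω ↦ ?_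
        simp only [Real.norm_eq_abs]
        nlinarith [sq_abs (M n ω), sq_nonneg (|M n ω| - 1)]
    _ = 1 + ∫ ω, M n ω ^ 2 ∂μ := by
        rw [integral_add (integrable_const 1) (hsq_int n)]; simp
    _ ≤ R := by
        rw [hR]
        gcongr
        refine (hsq n).trans ?_
        gcongr
        exact hβ.sum_le_tsum _ fun k _ ↦ sq_nonneg _

/-! ### Perturbed contractions along one path -/

section Deterministic

variable {E : Type*} [NormedAddCommGroup E] [NormedSpace ℝ E] {h : E → E} {κ C : ℝ} {w R : ℕ → E}
  {G g α : ℕ → ℝ}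

/-- One step of the recursion, after absorbing the noise into the iterate. -/
lemma norm_perturbed_step_le (hC : 0 ≤ C)
    (hw : ∀ t, w (t + 1) = w t + α t • (h (w t) - w t) + g t • (R t - R (t + 1)))
    (hα0 : ∀ t, 0 ≤ α t) (hg0 : ∀ t, 0 ≤ g t)
    (hg_step : ∀ t, |g (t + 1) - g t| ≤ C * α t * g t) {t : ℕ} {r : ℝ} (hα1 : α t ≤ 1)
    (hR0 : ‖R t‖ ≤ r) (hR1 : ‖R (t + 1)‖ ≤ r) (v : E) :
    ‖w (t + 1) - v + g (t + 1) • R (t + 1)‖ ≤ (1 - α t) * ‖w t - v + g t • R t‖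
      + α t * (‖h (w t) - v‖ + (1 + C) * (g t * r)) := by
  have hr : 0 ≤ r := (norm_nonneg _).trans hR0
  -- Summation by parts: after the shift by `g • R`, the noise enters only through `α t * g t` and
  -- the increment of `g`, both of the order of the step size, so the contraction can absorb them.
  have heq : w (t + 1) - v + g (t + 1) • R (t + 1) = (1 - α t) • (w t - v + g t • R t)
      + (α t • (h (w t) - v + g t • R t) + (g (t + 1) - g t) • R (t + 1)) := by
    rw [hw]; module
  rw [heq]
  have h1 : ‖g t • R t‖ ≤ g t * r := by
    rw [norm_smul, Real.norm_of_nonneg (hg0 t)]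
    exact mul_le_mul_of_nonneg_left hR0 (hg0 t)
  have h2 : ‖(g (t + 1) - g t) • R (t + 1)‖ ≤ C * α t * g t * r := by
    rw [norm_smul, Real.norm_eq_abs]
    exact mul_le_mul (hg_step t) hR1 (norm_nonneg _)
      (mul_nonneg (mul_nonneg hC (hα0 t)) (hg0 t))
  have h3 : ‖(1 - α t) • (w t - v + g t • R t)‖ = (1 - α t) * ‖w t - v + g t • R t‖ := by
    rw [norm_smul, Real.norm_of_nonneg (sub_nonneg.2 hα1)]
  have h4 : ‖α t • (h (w t) - v + g t • R t)‖ ≤ α t * (‖h (w t) - v‖ + g t * r) := by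
    rw [norm_smul, Real.norm_of_nonneg (hα0 t)]
    exact mul_le_mul_of_nonneg_left ((norm_add_le _ _).trans (by gcongr)) (hα0 t)
  refine (norm_add_le _ _).trans ?_
  rw [h3]
  have := norm_add_le (α t • (h (w t) - v + g t • R t)) ((g (t + 1) - g t) • R (t + 1))
  linarith

/-- Stability: the running maximum of the iterates is bounded if the noise, relative to the
running maximum, is summable. -/
lemma exists_runningMax_le {c : ℝ} (hκ1 : κ < 1)
    (hh : ∀ v, ‖h v‖ ≤ κ * ‖v‖ + c) (hκ0 : 0 ≤ κ) (hC : 0 ≤ C)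
    (hw : ∀ t, w (t + 1) = w t + α t • (h (w t) - w t) + g t • (R t - R (t + 1)))
    (hα0 : ∀ t, 0 ≤ α t) (hα1 : ∀ᶠ t in atTop, α t ≤ 1)
    (hwG : ∀ t, ‖w t‖ ≤ G t) (hG : ∀ t, G (t + 1) = max (G t) ‖w (t + 1)‖)
    (hg0 : ∀ t, 0 ≤ g t) (hgG : ∀ t, g t ≤ G t)
    (hg_step : ∀ t, |g (t + 1) - g t| ≤ C * α t * g t) (hR : Tendsto R atTop (𝓝 0)) :
    ∃ K, ∀ t, G t ≤ K := by
  -- The choice makes the perturbation `(1 + C) ε` and the margin `ε` in the invariant together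
  -- equal to half of the contraction gap; the other half absorbs `c`.
  set ε := (1 - κ) / (2 * (2 + C)) with hε
  have hκ' : 0 < 1 - κ := by linarith
  have hε0 : 0 < ε := by positivity
  have hεeq : (2 + C) * ε = (1 - κ) / 2 := by rw [hε]; field_simp
  have hε1 : ε ≤ 1 / 4 := by nlinarith
  have hRε : ∀ᶠ t in atTop, ‖R t‖ ≤ ε := by
    have := hR.norm
    rw [norm_zero] at this
    exact this.eventually_le_const hε0
  obtain ⟨t₀, ht₀⟩ := eventually_atTop.1 (hα1.and hRε)
  have hG0 : ∀ t, 0 ≤ G t := fun t ↦ (norm_nonneg _).trans (hwG t)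
  have hGmono : Monotone G := monotone_nat_of_le_succ fun t ↦ by rw [hG]; exact le_max_left _ _
  set K := max (2 * c / (1 - κ)) (2 * G t₀) with hK
  have hKc : c ≤ (1 - κ) / 2 * K := by
    have : 2 * c / (1 - κ) ≤ K := le_max_left _ _
    rw [div_le_iff₀ hκ'] at this
    linarith
  have hKG : 2 * G t₀ ≤ K := le_max_right _ _
  have hK0 : 0 ≤ K := (mul_nonneg zero_le_two (hG0 t₀)).trans hKG
  have key : ∀ t, t₀ ≤ t → ‖w t - 0 + g t • R t‖ ≤ (1 - ε) * K ∧ G t ≤ K := by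
    intro t ht
    induction t, ht using Nat.le_induction with
    | base =>
      refine ⟨?_, by linarith [hG0 t₀]⟩
      have h1 : ‖g t₀ • R t₀‖ ≤ G t₀ * ε := by
        rw [norm_smul, Real.norm_of_nonneg (hg0 _)]
        exact mul_le_mul (hgG _) (ht₀ t₀ le_rfl).2 (norm_nonneg _) (hG0 _)
      have h2 := norm_add_le (w t₀ - 0) (g t₀ • R t₀)
      rw [sub_zero] at h2 ⊢
      nlinarith [hwG t₀, hG0 t₀]
    | succ t ht ih =>
      obtain ⟨ih1, ih2⟩ := ih
      have hstep := norm_perturbed_step_le hC hw hα0 hg0 hg_step (ht₀ t ht).1 (ht₀ t ht).2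
        (ht₀ (t + 1) (by omega)).2 0
      have hx : ‖w (t + 1) - 0 + g (t + 1) • R (t + 1)‖ ≤ (1 - ε) * K := by
        have h1 : ‖h (w t) - 0‖ ≤ κ * K + c := by
          rw [sub_zero]
          exact (hh _).trans (by gcongr; exact (hwG t).trans ih2)
        have h2 : g t * ε ≤ K * ε := by gcongr; exact (hgG t).trans ih2
        have h3 : ‖h (w t) - 0‖ + (1 + C) * (g t * ε) ≤ (1 - ε) * K := by
          have h4 : (1 + C) * (g t * ε) ≤ (1 + C) * (K * ε) := by gcongr
          have h5 : (1 + C) * (K * ε) + ε * K = (1 - κ) / 2 * K := by rw [← hεeq]; ring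
          linarith
        have h6 := mul_le_mul_of_nonneg_left h3 (hα0 t)
        have h7 := mul_le_mul_of_nonneg_left ih1 (sub_nonneg.2 (ht₀ t ht).1)
        linarith
      refine ⟨hx, ?_⟩
      rw [hG]
      refine max_le ih2 ?_
      -- At a new maximum, `G (t + 1) = ‖w (t + 1)‖`, so undoing the shift costs at most `ε ‖w (t +
      -- 1)‖`. This is why the invariant carries the factor `1 - ε`.
      rcases le_total ‖w (t + 1)‖ (G t) with hle | hle
      · exact hle.trans ih2
      · have h1 : ‖g (t + 1) • R (t + 1)‖ ≤ ‖w (t + 1)‖ * ε := by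
          rw [norm_smul, Real.norm_of_nonneg (hg0 _)]
          refine mul_le_mul ((hgG _).trans ?_) (ht₀ (t + 1) (by omega)).2 (norm_nonneg _)
            (norm_nonneg _)
          rw [hG, max_eq_right hle]
        have h2 := norm_sub_le (w (t + 1) - 0 + g (t + 1) • R (t + 1)) (g (t + 1) • R (t + 1))
        rw [add_sub_cancel_right, sub_zero] at h2
        rw [sub_zero] at hx
        have h3 : (1 - ε) * ‖w (t + 1)‖ ≤ (1 - ε) * K := by linarith
        exact le_of_mul_le_mul_left h3 (by linarith)
  exact ⟨K, fun t ↦ (hGmono (le_max_left t t₀)).trans (key _ (le_max_right t t₀)).2⟩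

/-- Rate of convergence of a perturbed contraction. -/
lemma exists_eventually_norm_sub_le {γ : ℕ → ℝ} {v : E} {K : ℝ} (hκ1 : κ < 1)
    (hh : ∀ u, ‖h u - v‖ ≤ κ * ‖u - v‖) (hκ0 : 0 ≤ κ) (hC : 0 ≤ C)
    (hw : ∀ t, w (t + 1) = w t + α t • (h (w t) - w t) + g t • (R t - R (t + 1)))
    (hα0 : ∀ t, 0 ≤ α t) (hα1 : ∀ᶠ t in atTop, α t ≤ 1)
    (hg0 : ∀ t, 0 ≤ g t) (hgγ : ∀ t, g t ≤ K * γ t) (hγ0 : ∀ t, 0 < γ t)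
    (hγ : ∀ᶠ t in atTop, (1 - (1 - κ) / 2 * α t) * γ t ≤ γ (t + 1))
    (hg_step : ∀ t, |g (t + 1) - g t| ≤ C * α t * g t) (hR : Tendsto R atTop (𝓝 0)) :
    ∃ D, ∀ᶠ t in atTop, ‖w t - v‖ ≤ D * γ t := by
  have hκ' : 0 < 1 - κ := by linarith
  have hR1 : ∀ᶠ t in atTop, ‖R t‖ ≤ 1 := by
    have := hR.norm
    rw [norm_zero] at this
    exact this.eventually_le_const one_pos
  obtain ⟨t₀, ht₀⟩ := eventually_atTop.1 (hα1.and (hR1.and hγ))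
  have hK0 : 0 ≤ K := le_of_mul_le_mul_right
    (by rw [zero_mul]; exact (hg0 0).trans (hgγ 0)) (hγ0 0)
  -- The first entry lets half of the gap dominate the forcing: `1 + C` from the step and `1` from
  -- undoing the shift. The second covers the start `t₀`.
  set D := max (2 * (K * (2 + C)) / (1 - κ)) (‖w t₀ - v + g t₀ • R t₀‖ / γ t₀) with hD
  have hD1 : K * (2 + C) ≤ (1 - κ) / 2 * D := by
    have : 2 * (K * (2 + C)) / (1 - κ) ≤ D := le_max_left _ _
    rw [div_le_iff₀ hκ'] at this
    linarith
  have hgR : ∀ t, t₀ ≤ t → ‖g t • R t‖ ≤ K * γ t := fun t ht ↦ by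
    rw [norm_smul, Real.norm_of_nonneg (hg0 _), ← mul_one (K * γ t)]
    exact mul_le_mul (hgγ t) (ht₀ t ht).2.1 (norm_nonneg _) ((hg0 t).trans (hgγ t))
  have hsub : ∀ t, t₀ ≤ t → ‖w t - v‖ ≤ ‖w t - v + g t • R t‖ + K * γ t := fun t ht ↦ by
    have h2 := norm_sub_le (w t - v + g t • R t) (g t • R t)
    rw [add_sub_cancel_right] at h2
    linarith [hgR t ht]
  have key : ∀ t, t₀ ≤ t → ‖w t - v + g t • R t‖ ≤ D * γ t := by
    intro t ht
    induction t, ht using Nat.le_induction with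
    | base =>
      rw [← div_le_iff₀ (hγ0 _)]
      exact le_max_right _ _
    | succ t ht ih =>
      obtain ⟨ha1, hr, hγt⟩ := ht₀ t ht
      have hstep := norm_perturbed_step_le hC hw hα0 hg0 hg_step ha1 hr
        (ht₀ (t + 1) (by omega)).2.1 v
      have hD0 : 0 ≤ D := le_of_mul_le_mul_left (a := (1 - κ) / 2)
        (by rw [mul_zero]; exact le_trans (by positivity) hD1) (by positivity)
      have h1 : ‖h (w t) - v‖ ≤ κ * (D * γ t) + K * γ t := by
        have h2 := mul_le_mul_of_nonneg_left ((hsub t ht).trans (add_le_add_left ih _)) hκ0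
        have h3 : κ * (K * γ t) ≤ 1 * (K * γ t) :=
          mul_le_mul_of_nonneg_right hκ1.le (mul_nonneg hK0 (hγ0 t).le)
        linarith [hh (w t)]
      have h4 : (1 + C) * (g t * 1) ≤ (1 + C) * (K * γ t) := by
        rw [mul_one]; gcongr; exact hgγ t
      have h5 : ‖h (w t) - v‖ + (1 + C) * (g t * 1) ≤ (κ * D + (1 - κ) / 2 * D) * γ t := by
        nlinarith [mul_le_mul_of_nonneg_right hD1 (hγ0 t).le]
      have h6 := mul_le_mul_of_nonneg_left h5 (hα0 t)
      have h7 := mul_le_mul_of_nonneg_left ih (sub_nonneg.2 ha1)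
      have h8 := mul_le_mul_of_nonneg_left hγt hD0
      linarith
  refine ⟨D + K, eventually_atTop.2 ⟨t₀, fun t ht ↦ ?_⟩⟩
  rw [add_mul]
  exact (hsub t ht).trans (by gcongr; exact key t ht)

end Deterministic

/-! ### Elementary estimates -/

/-- Bernoulli gives `(1 + 1/s)^a ≤ 1 + a/s`, and `(1 - x)(1 + x) ≤ 1`. It ensures that the rate `γ`
decays no faster than the contraction allows. -/
lemma Real.one_sub_div_mul_rpow_neg_le {a s : ℝ} (ha0 : 0 ≤ a) (ha1 : a ≤ 1) (hs : 0 < s) :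
    (1 - a / s) * s ^ (-a) ≤ (s + 1) ^ (-a) := by
  have h1 : (1 + 1 / s) ^ a ≤ 1 + a * (1 / s) :=
    rpow_one_add_le_one_add_mul_self (by have : 0 < 1 / s := by positivity
                                         linarith) ha0 ha1
  have h2 : s + 1 = s * (1 + 1 / s) := by field_simp
  have h3 : (0 : ℝ) < 1 + 1 / s := by positivity
  rw [h2, Real.mul_rpow hs.le h3.le, mul_comm]
  gcongr
  rw [Real.rpow_neg h3.le, ← one_div, le_div_iff₀ (Real.rpow_pos_of_pos h3 a)]
  have hx : 0 ≤ a / s := by positivity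
  have hp : 0 < (1 + 1 / s) ^ a := Real.rpow_pos_of_pos h3 a
  rw [mul_one_div] at h1
  rcases le_total (a / s) 1 with h | h
  · nlinarith [mul_le_mul_of_nonneg_left h1 (sub_nonneg.2 h)]
  · nlinarith [mul_nonneg (sub_nonneg.2 h) hp.le]

lemma abs_le_mul_one_add_norm {E 𝒴 : Type*} [NormedAddCommGroup E] {f : E → 𝒴 → ℝ} {A : ℝ}
    (hf_lip : ∀ v v' y, |f v y - f v' y| ≤ A * ‖v - v'‖) (hf_zero : ∀ y, |f 0 y| ≤ A) (v : E)
    (y : 𝒴) : |f v y| ≤ A * (1 + ‖v‖) := by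
  have h1 := hf_lip v 0 y
  have h2 := abs_add_le (f v y - f 0 y) (f 0 y)
  rw [sub_add_cancel] at h2
  rw [sub_zero] at h1
  linarith [hf_zero y]

lemma continuous_of_abs_sub_le {E : Type*} [NormedAddCommGroup E] {f : E → ℝ} {A : ℝ}
    (hf : ∀ v v', |f v - f v'| ≤ A * ‖v - v'‖) : Continuous f :=
  (LipschitzWith.of_dist_le' (K := A) fun v v' ↦ by
    rw [Real.dist_eq, dist_eq_norm]; exact hf v v').continuous

/-! ### Summability of the normalised Markovian noise -/

section Noise

variable {E : Type*} [NormedAddCommGroup E] [NormedSpace ℝ E] [FiniteDimensional ℝ E]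
  [MeasurableSpace E] [BorelSpace E]
  {Ω 𝒴 : Type*} {mΩ : MeasurableSpace Ω} [MeasurableSpace 𝒴] {P : Kernel 𝒴 𝒴}
  [IsMarkovKernel P] {d : Measure 𝒴} [IsProbabilityMeasure d]
  {𝓕 : Filtration ℕ mΩ} {Y : ℕ → Ω → 𝒴} {μ : Measure Ω} [IsProbabilityMeasure μ]

/-- A Carathéodory function: continuous in `v` and measurable in `y`. -/
lemma measurable_uncurry_of_abs_sub_le {f : E → 𝒴 → ℝ} {A : ℝ} (hf_meas : ∀ v, Measurable (f v))
    (hf : ∀ v v' y, |f v y - f v' y| ≤ A * ‖v - v'‖) : Measurable (Function.uncurry f) := by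
  have := FiniteDimensional.proper_real E
  exact measurable_uncurry_of_continuous_of_measurable
    (fun y ↦ continuous_of_abs_sub_le fun v v' ↦ hf v v' y) hf_meas

/-- The noise of a real-valued update function, divided by a bound on the iterates, is almost
surely summable against square-summable weights. -/
lemma ae_exists_tendsto_sum_noise (hP : GeometricallyMixing P d) (hY : IsMarkovChain P 𝓕 Y μ)
    {f : E → 𝒴 → ℝ} {A : ℝ} (hf_meas : ∀ v, Measurable (f v))
    (hf_lip : ∀ v v' y, |f v y - f v' y| ≤ A * ‖v - v'‖) (hf_zero : ∀ y, |f 0 y| ≤ A)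
    {w : ℕ → Ω → E} {G : ℕ → Ω → ℝ} {α β : ℕ → ℝ} {C : ℝ}
    (hw_meas : ∀ t, Measurable[𝓕 t] (w t)) (hG_meas : ∀ t, Measurable[𝓕 t] (G t))
    (hG_one : ∀ t ω, 1 ≤ G t ω) (hwG : ∀ t ω, ‖w t ω‖ ≤ G t ω)
    (hG_mono : ∀ t ω, G t ω ≤ G (t + 1) ω)
    (hG_step : ∀ t ω, G (t + 1) ω - G t ω ≤ C * α t * G t ω)
    (hw_step : ∀ t ω, ‖w (t + 1) ω - w t ω‖ ≤ C * α t * G t ω)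
    (hC : 0 ≤ C) (hα0 : ∀ t, 0 ≤ α t) (hαβ : ∀ t, α t ≤ β t) (hβ_anti : Antitone β)
    (hβ_zero : Tendsto β atTop (𝓝 0)) (hβ_sq : Summable fun t ↦ β t ^ 2) :
    ∀ᵐ ω ∂μ, ∃ l, Tendsto (fun n ↦ ∑ k ∈ Finset.range n,
      β k * ((f (w k ω) (Y (k + 1) ω) - ∫ y, f (w k ω) y ∂d) / G k ω)) atTop (𝓝 l) := by
  obtain ⟨K, hK0, hK⟩ := hP.exists_abs_poissonSeries_le
  rcases isEmpty_or_nonempty 𝒴 with hempty | ⟨⟨y₀⟩⟩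
  · exact ae_of_all _ fun ω ↦ (hempty.false (Y 0 ω)).elim
  have hA0 : 0 ≤ A := (abs_nonneg _).trans (hf_zero y₀)
  have hf_bdd := abs_le_mul_one_add_norm hf_lip hf_zero
  have hint : ∀ v (m : Measure 𝒴) [IsFiniteMeasure m], Integrable (f v) m := fun v m _ ↦
    Integrable.of_bound (hf_meas v).aestronglyMeasurable _ (ae_of_all _ (hf_bdd v))
  set q : E → 𝒴 → ℝ := fun v ↦ poissonSeries P d (f v) with hq
  set fbar : E → ℝ := fun v ↦ ∫ y, f v y ∂d with hfbar
  have hq_bdd : ∀ v y, |q v y| ≤ A * (1 + ‖v‖) * K := fun v y ↦ hK _ _ (hf_meas v) (hf_bdd v) y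
  have hq_lip : ∀ v v' y, |q v y - q v' y| ≤ A * K * ‖v - v'‖ := fun v v' y ↦ by
    rw [hq, ← hP.poissonSeries_sub (hf_meas v) (hf_bdd v) (hf_meas v') (hf_bdd v')]
    refine (hK _ (A * ‖v - v'‖) ((hf_meas v).sub (hf_meas v')) (hf_lip v v') y).trans (le_of_eq ?_)
    ring
  have hq_meas : ∀ v, Measurable (q v) := fun v ↦ hP.measurable_poissonSeries (hf_meas v) (hf_bdd v)
  have hfbar_lip : ∀ v v', |fbar v - fbar v'| ≤ A * ‖v - v'‖ := fun v v' ↦ by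
    rw [hfbar, ← integral_sub (hint v d) (hint v' d)]
    simpa using norm_integral_le_of_norm_le_const (μ := d) (f := fun y ↦ f v y - f v' y)
      (ae_of_all _ (hf_lip v v'))
  have hfbar_bdd : ∀ v, |fbar v| ≤ A * (1 + ‖v‖) := fun v ↦ by
    simpa using norm_integral_le_of_norm_le_const (μ := d) (f := f v) (ae_of_all _ (hf_bdd v))
  have hf_unc := measurable_uncurry_of_abs_sub_le hf_meas hf_lip
  have hq_unc := measurable_uncurry_of_abs_sub_le hq_meas hq_lip
  have hfbar_meas : Measurable fbar := (continuous_of_abs_sub_le hfbar_lip).measurable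
  -- The martingale part of the noise. It is bounded because `f`, `fbar` and `q` grow at most
  -- linearly in `‖w‖ ≤ G`.
  set D : ℕ → Ω → ℝ := fun n ω ↦ (f (w n ω) (Y (n + 1) ω) - fbar (w n ω) + q (w n ω) (Y (n + 1) ω)
    - q (w n ω) (Y n ω)) / G n ω with hD
  set Z : ℕ → Ω → ℝ := fun n ω ↦ q (w n ω) (Y n ω) / G n ω with hZ
  have hGpos : ∀ t ω, 0 < G t ω := fun t ω ↦ one_pos.trans_le (hG_one t ω)
  have hAG : ∀ t ω, A * (1 + ‖w t ω‖) ≤ 2 * A * G t ω := fun t ω ↦ by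
    nlinarith [hG_one t ω, hwG t ω]
  have hqG : ∀ t ω y, |q (w t ω) y| ≤ 2 * A * K * G t ω := fun t ω y ↦ by
    refine (hq_bdd _ _).trans ?_
    nlinarith [mul_le_mul_of_nonneg_right (hAG t ω) hK0]
  have hD_bdd : ∀ n ω, |D n ω| ≤ 4 * A * (1 + K) := fun n ω ↦ by
    rw [hD, abs_div, abs_of_pos (hGpos n ω), div_le_iff₀ (hGpos n ω)]
    have h1 := (hf_bdd (w n ω) (Y (n + 1) ω)).trans (hAG n ω)
    have h2 := (hfbar_bdd (w n ω)).trans (hAG n ω)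
    have h3 := hqG n ω (Y (n + 1) ω)
    have h4 := hqG n ω (Y n ω)
    rw [abs_le] at *
    constructor <;> linarith
  have hD_meas : ∀ n, Measurable[𝓕 (n + 1)] (D n) := fun n ↦ by
    have hw' : Measurable[𝓕 (n + 1)] (w n) := (hw_meas n).mono (𝓕.mono n.le_succ) le_rfl
    have hY' : Measurable[𝓕 (n + 1)] (Y n) := (hY.adapted n).mono (𝓕.mono n.le_succ) le_rfl
    have hG' : Measurable[𝓕 (n + 1)] (G n) := (hG_meas n).mono (𝓕.mono n.le_succ) le_rfl
    exact ((((hf_unc.comp (hw'.prodMk (hY.adapted (n + 1)))).sub (hfbar_meas.comp hw')).add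
      (hq_unc.comp (hw'.prodMk (hY.adapted (n + 1))))).sub (hq_unc.comp (hw'.prodMk hY'))).div hG'
  have hD_orth : ∀ n (c : Ω → ℝ), Measurable[𝓕 n] c → (∃ K, ∀ ω, |c ω| ≤ K) →
      ∫ ω, c ω * D n ω ∂μ = 0 := by
    rintro n c hc ⟨K', hK'⟩
    -- The past data `c`, `w n`, `G n` and `Y n` are frozen, so that the Poisson equation applies to
    -- the integral over `Y (n + 1)`.
    set F : ((ℝ × E × ℝ) × 𝒴) × 𝒴 → ℝ := fun p ↦ p.1.1.1 *
      ((f p.1.1.2.1 p.2 - fbar p.1.1.2.1 + q p.1.1.2.1 p.2 - q p.1.1.2.1 p.1.2) / p.1.1.2.2)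
      with hF
    have hF_meas : Measurable F := by
      have hv : Measurable fun p : ((ℝ × E × ℝ) × 𝒴) × 𝒴 ↦ p.1.1.2.1 := by fun_prop
      have hy : Measurable fun p : ((ℝ × E × ℝ) × 𝒴) × 𝒴 ↦ p.1.2 := by fun_prop
      have hy' : Measurable fun p : ((ℝ × E × ℝ) × 𝒴) × 𝒴 ↦ p.2 := by fun_prop
      have hg : Measurable fun p : ((ℝ × E × ℝ) × 𝒴) × 𝒴 ↦ p.1.1.2.2 := by fun_prop
      have hc' : Measurable fun p : ((ℝ × E × ℝ) × 𝒴) × 𝒴 ↦ p.1.1.1 := by fun_prop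
      exact hc'.mul (((((hf_unc.comp (hv.prodMk hy')).sub (hfbar_meas.comp hv)).add
        (hq_unc.comp (hv.prodMk hy'))).sub (hq_unc.comp (hv.prodMk hy))).div hg)
    have hU : Measurable[𝓕 n] fun ω ↦ (c ω, w n ω, G n ω) :=
      hc.prodMk ((hw_meas n).prodMk (hG_meas n))
    have h1 := hY.integral_eq n hU hF_meas (C := K' * (4 * A * (1 + K))) fun ω ↦ by
      have : F (((c ω, w n ω, G n ω), Y n ω), Y (n + 1) ω) = c ω * D n ω := rfl
      rw [this, abs_mul]
      exact mul_le_mul (hK' ω) (hD_bdd n ω) (abs_nonneg _) ((abs_nonneg _).trans (hK' ω))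
    refine h1.trans ?_
    refine integral_eq_zero_of_ae (ae_of_all _ fun ω ↦ ?_)
    have hqi : ∀ v, Integrable (q v) (P (Y n ω)) := fun v ↦
      Integrable.of_bound (hq_meas v).aestronglyMeasurable _ (ae_of_all _ (hq_bdd v))
    have hgi : Integrable (fun y ↦ f (w n ω) y - fbar (w n ω) + q (w n ω) y) (P (Y n ω)) :=
      ((hint _ _).sub (integrable_const _)).add (hqi _)
    simp only [hF, Pi.zero_apply]
    rw [integral_const_mul, integral_div, integral_sub hgi (integrable_const _),
      hP.integral_add_poissonSeries (hf_meas _) (hf_bdd _)]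
    simp [hq]
  filter_upwards [ae_exists_tendsto_sum_of_martingale_difference hD_meas hD_bdd hD_orth hβ_sq]
    with ω ⟨l₁, hl₁⟩
  have hZ_bdd : ∀ n, |Z n ω| ≤ 2 * A * K := fun n ↦ by
    rw [hZ, abs_div, abs_of_pos (hGpos n ω), div_le_iff₀ (hGpos n ω)]
    exact hqG _ _ _
  -- Dirichlet's test: the telescoping sums of `Z` are bounded and `β` decreases to zero.
  obtain ⟨l₂, hl₂⟩ := cauchySeq_tendsto_of_complete <|
    hβ_anti.cauchySeq_series_mul_of_tendsto_zero_of_bounded hβ_zero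
      (z := fun n ↦ Z n ω - Z (n + 1) ω) (b := 4 * A * K) fun n ↦ by
        rw [Finset.sum_range_sub', Real.norm_eq_abs]
        refine (abs_sub _ _).trans ?_
        linarith [hZ_bdd 0, hZ_bdd n]
  -- The price of telescoping: `Z (n + 1)` uses `w (n + 1)` and `G (n + 1)` where the decomposition
  -- has `w n` and `G n`. One step changes these by `O(α n)` relative to `G n`, so `β n * e n = O(β
  -- n ^ 2)`.
  set e : ℕ → ℝ := fun n ↦ Z (n + 1) ω - q (w n ω) (Y (n + 1) ω) / G n ω with he
  have he_bdd : ∀ n, |e n| ≤ 3 * A * K * C * α n := fun n ↦ by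
    have hg := hGpos n ω
    have hg' := hGpos (n + 1) ω
    have hsplit : e n = q (w (n + 1) ω) (Y (n + 1) ω) / G (n + 1) ω *
        (-((G (n + 1) ω - G n ω) / G n ω)) +
        (q (w (n + 1) ω) (Y (n + 1) ω) - q (w n ω) (Y (n + 1) ω)) / G n ω := by
      simp only [he, hZ]; field_simp; ring
    have h1 : |(G (n + 1) ω - G n ω) / G n ω| ≤ C * α n := by
      rw [abs_div, abs_of_pos hg, div_le_iff₀ hg, abs_of_nonneg (sub_nonneg.2 (hG_mono n ω))]
      exact hG_step n ω
    have h2 : |(q (w (n + 1) ω) (Y (n + 1) ω) - q (w n ω) (Y (n + 1) ω)) / G n ω|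
        ≤ A * K * (C * α n) := by
      rw [abs_div, abs_of_pos hg, div_le_iff₀ hg]
      refine (hq_lip _ _ _).trans ?_
      rw [mul_assoc (A * K)]
      gcongr
      exact hw_step n ω
    have h3 : |q (w (n + 1) ω) (Y (n + 1) ω) / G (n + 1) ω * (-((G (n + 1) ω - G n ω) / G n ω))|
        ≤ 2 * A * K * (C * α n) := by
      rw [abs_mul, abs_neg]
      exact mul_le_mul (hZ_bdd (n + 1)) h1 (abs_nonneg _) (by positivity)
    rw [hsplit]
    refine (abs_add_le _ _).trans ?_
    linarith
  have he_sum : Summable fun n ↦ β n * e n := by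
    refine Summable.of_norm_bounded (g := fun n ↦ 3 * A * K * C * β n ^ 2) (hβ_sq.mul_left _)
      fun n ↦ ?_
    have hβ0 := (hα0 n).trans (hαβ n)
    rw [Real.norm_eq_abs, abs_mul, abs_of_nonneg hβ0]
    have h1 : 3 * A * K * C * α n ≤ 3 * A * K * C * β n := by gcongr; exact hαβ n
    nlinarith [mul_le_mul_of_nonneg_left ((he_bdd n).trans h1) hβ0]
  refine ⟨l₁ + l₂ + _, ((hl₁.add hl₂).add he_sum.hasSum.tendsto_sum_nat).congr fun n ↦ ?_⟩
  rw [← Finset.sum_add_distrib, ← Finset.sum_add_distrib]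
  refine Finset.sum_congr rfl fun k _ ↦ ?_
  simp only [hD, hZ, he, smul_eq_mul]
  ring

/-- Vector-valued version of `ae_exists_tendsto_sum_noise`. -/
lemma ae_exists_tendsto_sum_smul_noise (hP : GeometricallyMixing P d)
    (hY : IsMarkovChain P 𝓕 Y μ)
    {H : E → 𝒴 → E} {L B : ℝ} (hH_meas : ∀ v, Measurable (H v))
    (hH_lip : ∀ v v' y, ‖H v y - H v' y‖ ≤ L * ‖v - v'‖) (hH_zero : ∀ y, ‖H 0 y‖ ≤ B)
    {w : ℕ → Ω → E} {G : ℕ → Ω → ℝ} {α β : ℕ → ℝ} {C : ℝ}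
    (hw_meas : ∀ t, Measurable[𝓕 t] (w t)) (hG_meas : ∀ t, Measurable[𝓕 t] (G t))
    (hG_one : ∀ t ω, 1 ≤ G t ω) (hwG : ∀ t ω, ‖w t ω‖ ≤ G t ω)
    (hG_mono : ∀ t ω, G t ω ≤ G (t + 1) ω)
    (hG_step : ∀ t ω, G (t + 1) ω - G t ω ≤ C * α t * G t ω)
    (hw_step : ∀ t ω, ‖w (t + 1) ω - w t ω‖ ≤ C * α t * G t ω)
    (hC : 0 ≤ C) (hα0 : ∀ t, 0 ≤ α t) (hαβ : ∀ t, α t ≤ β t) (hβ_anti : Antitone β)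
    (hβ_zero : Tendsto β atTop (𝓝 0)) (hβ_sq : Summable fun t ↦ β t ^ 2) :
    ∀ᵐ ω ∂μ, ∃ l : E, Tendsto (fun n ↦ ∑ k ∈ Finset.range n, β k • ((G k ω)⁻¹ •
      (H (w k ω) (Y (k + 1) ω) - meanOperator H d (w k ω)))) atTop (𝓝 l) := by
  have := FiniteDimensional.proper_real E
  have hH_bdd : ∀ v y, ‖H v y‖ ≤ L * ‖v‖ + B := fun v y ↦ by
    have h1 := hH_lip v 0 y
    have h2 := norm_add_le (H v y - H 0 y) (H 0 y)
    rw [sub_add_cancel] at h2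
    rw [sub_zero] at h1
    linarith [hH_zero y]
  have hH_int : ∀ v, Integrable (H v) d := fun v ↦
    Integrable.of_bound (hH_meas v).aestronglyMeasurable _ (ae_of_all _ (hH_bdd v))
  -- Coordinate functionals are bounded for any norm on `E`, so the scalar case applies to each
  -- coordinate.
  let b := Module.finBasis ℝ E
  let φ : Fin (Module.finrank ℝ E) → E →L[ℝ] ℝ := fun i ↦ LinearMap.toContinuousLinearMap (b.coord i)
  have hφ : ∀ i, ∀ᵐ ω ∂μ, ∃ l, Tendsto (fun n ↦ ∑ k ∈ Finset.range n, β k *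
      ((φ i (H (w k ω) (Y (k + 1) ω)) - ∫ y, φ i (H (w k ω) y) ∂d) / G k ω)) atTop (𝓝 l) := by
    intro i
    refine ae_exists_tendsto_sum_noise (A := ‖φ i‖ * max L B) (f := fun v y ↦ φ i (H v y)) hP hY
      (fun v ↦ (φ i).measurable.comp (hH_meas v)) (fun v v' y ↦ ?_) (fun y ↦ ?_) hw_meas hG_meas
      hG_one hwG hG_mono hG_step hw_step hC hα0 hαβ hβ_anti hβ_zero hβ_sq
    · rw [← map_sub, mul_assoc]
      refine ((φ i).le_opNorm _).trans ?_
      gcongr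
      exact (hH_lip v v' y).trans (by gcongr; exact le_max_left _ _)
    · refine ((φ i).le_opNorm _).trans ?_
      gcongr
      exact (hH_zero y).trans (le_max_right _ _)
  filter_upwards [ae_all_iff.2 hφ] with ω hω
  choose l hl using hω
  refine ⟨∑ i, l i • b i, (tendsto_finsetSum _ fun i _ ↦ (hl i).smul_const (b i)).congr fun n ↦ ?_⟩
  rw [← b.sum_repr (∑ k ∈ Finset.range n, β k • ((G k ω)⁻¹ •
      (H (w k ω) (Y (k + 1) ω) - meanOperator H d (w k ω))))]
  refine Finset.sum_congr rfl fun i _ ↦ ?_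
  congr 1
  change _ = φ i _
  rw [map_sum]
  refine Finset.sum_congr rfl fun k _ ↦ ?_
  rw [(φ i).integral_comp_comm (hH_int _), map_smul, map_smul, map_sub, meanOperator, smul_eq_mul,
    smul_eq_mul, div_eq_inv_mul]

end Noise

/-! ### From noise to almost sure rates -/

/-- The running maximum of a sequence, started at `1`. -/
noncomputable def runningMax (x : ℕ → ℝ) : ℕ → ℝ
  | 0 => max 1 (x 0)
  | n + 1 => max (runningMax x n) (x (n + 1))

lemma one_le_runningMax (x : ℕ → ℝ) (n : ℕ) : 1 ≤ runningMax x n := by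
  induction n with
  | zero => exact le_max_left _ _
  | succ n ih => exact ih.trans (le_max_left _ _)

lemma le_runningMax (x : ℕ → ℝ) (n : ℕ) : x n ≤ runningMax x n := by
  cases n <;> exact le_max_right _ _

lemma tendsto_natCast_add_three_rpow_neg {p : ℝ} (hp : 0 < p) :
    Tendsto (fun t : ℕ ↦ ((t : ℝ) + 3) ^ (-p)) atTop (𝓝 0) :=
  (tendsto_rpow_neg_atTop hp).comp
    (tendsto_atTop_add_const_right _ _ tendsto_natCast_atTop_atTop)

lemma antitone_natCast_add_three_rpow_neg {p : ℝ} (hp : 0 ≤ p) :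
    Antitone fun t : ℕ ↦ ((t : ℝ) + 3) ^ (-p) := fun m n hmn ↦
  Real.rpow_le_rpow_of_nonpos (by positivity)
    (by have : (m : ℝ) ≤ n := by exact_mod_cast hmn
        linarith) (by linarith)

lemma tendsto_mul_norm_sq_of_eventually_le {E : Type*} [NormedAddCommGroup E] {x : ℕ → E}
    {r γ : ℕ → ℝ} {D : ℝ} (hx : ∀ᶠ t in atTop, ‖x t‖ ≤ D * γ t) (hr : ∀ t, 0 ≤ r t)
    (hrγ : Tendsto (fun t ↦ r t * γ t ^ 2) atTop (𝓝 0)) :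
    Tendsto (fun t ↦ r t * ‖x t‖ ^ 2) atTop (𝓝 0) := by
  have h := hrγ.const_mul (D ^ 2)
  rw [mul_zero] at h
  refine squeeze_zero' (.of_forall fun t ↦ mul_nonneg (hr t) (sq_nonneg _)) ?_ h
  filter_upwards [hx] with t ht
  have h1 := pow_le_pow_left₀ (norm_nonneg _) ht 2
  have h2 := mul_le_mul_of_nonneg_left h1 (hr t)
  rw [mul_pow] at h2
  linarith

lemma exists_forall_eq_iff_eq_of_contraction {E : Type*} [NormedAddCommGroup E] [CompleteSpace E]
    {h : E → E} {κ : ℝ} (hκ0 : 0 ≤ κ) (hκ1 : κ < 1)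
    (hh : ∀ v v', ‖h v - h v'‖ ≤ κ * ‖v - v'‖) : ∃ vstar, ∀ v, h v = v ↔ v = vstar := by
  have hc : ContractingWith ⟨κ, hκ0⟩ h := by
    refine ⟨by exact_mod_cast hκ1, LipschitzWith.of_dist_le_mul fun v v' ↦ ?_⟩
    rw [dist_eq_norm, dist_eq_norm]
    exact hh v v'
  refine ⟨hc.fixedPoint, fun v ↦ ⟨fun hv ↦ hc.fixedPoint_unique hv, ?_⟩⟩
  rintro rfl
  exact hc.fixedPoint_isFixedPt

/-- Almost sure polynomial rate of convergence of stochastic approximation driven by a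
geometrically mixing Markov chain. -/
lemma ae_exists_eventually_norm_sub_le_rpow
    {E : Type*} [NormedAddCommGroup E] [NormedSpace ℝ E] [FiniteDimensional ℝ E]
    [MeasurableSpace E] [BorelSpace E]
    {Ω : Type*} {mΩ : MeasurableSpace Ω} {μ : Measure Ω} [IsProbabilityMeasure μ]
    {𝒴 : Type*} [MeasurableSpace 𝒴]
    {P : Kernel 𝒴 𝒴} [IsMarkovKernel P] {d : Measure 𝒴} [IsProbabilityMeasure d]
    (hP : GeometricallyMixing P d)
    {𝓕 : Filtration ℕ mΩ} {Y : ℕ → Ω → 𝒴} (hY : IsMarkovChain P 𝓕 Y μ)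
    {H : E → 𝒴 → E} (hH_meas : ∀ w, Measurable (H w)) {κ L B : ℝ} (hκ0 : 0 ≤ κ) (hκ1 : κ < 1)
    (hH_contr : ∀ w w', ‖meanOperator H d w - meanOperator H d w'‖ ≤ κ * ‖w - w'‖)
    (hL : 0 ≤ L) (hB : 0 ≤ B) (hH_lip : ∀ w w' y, ‖H w y - H w' y‖ ≤ L * ‖w - w'‖)
    (hH_zero : ∀ y, ‖H 0 y‖ ≤ B)
    {Cα ν a : ℝ} (hCα : 0 < Cα) (hν1 : ν ≤ 1) (ha0 : 0 < a) (haν : a < ν - 1 / 2)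
    {α : ℕ → ℝ} (hα : ∀ t : ℕ, α t = Cα / ((t : ℝ) + 3) ^ ν)
    (haα : ∀ᶠ t : ℕ in atTop, a / ((t : ℝ) + 3) ≤ (1 - κ) / 2 * α t)
    {w : ℕ → Ω → E} (hw_zero : Measurable[𝓕 0] (w 0))
    (hw_succ : ∀ t ω, w (t + 1) ω = w t ω + α t • (H (w t ω) (Y (t + 1) ω) - w t ω))
    {wstar : E} (hwstar : meanOperator H d wstar = wstar) :
    ∀ᵐ ω ∂μ, ∃ D, ∀ᶠ t : ℕ in atTop, ‖w t ω - wstar‖ ≤ D * ((t : ℝ) + 3) ^ (-a) := by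
  have := FiniteDimensional.proper_real E
  have hs : ∀ t : ℕ, (0 : ℝ) < t + 3 := fun t ↦ by positivity
  have hs1 : ∀ t : ℕ, (1 : ℝ) ≤ t + 3 := fun t ↦ by
    have : (0 : ℝ) ≤ t := t.cast_nonneg
    linarith
  have hα' : ∀ t : ℕ, α t = Cα * ((t : ℝ) + 3) ^ (-ν) := fun t ↦ by
    rw [hα, Real.rpow_neg (hs t).le, div_eq_mul_inv]
  have hα0 : ∀ t, 0 ≤ α t := fun t ↦ by
    rw [hα']
    exact mul_nonneg hCα.le (Real.rpow_nonneg (hs t).le _)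
  have hα_lim : Tendsto α atTop (𝓝 0) := by
    rw [funext hα', ← mul_zero Cα]
    exact (tendsto_natCast_add_three_rpow_neg (by linarith)).const_mul Cα
  set γ : ℕ → ℝ := fun t ↦ ((t : ℝ) + 3) ^ (-a) with hγ
  have hγ0 : ∀ t, 0 < γ t := fun t ↦ Real.rpow_pos_of_pos (hs t) _
  have hγ1 : ∀ t, γ t ≤ 1 := fun t ↦ Real.rpow_le_one_of_one_le_of_nonpos (hs1 t) (by linarith)
  have hγ_anti : Antitone γ := antitone_natCast_add_three_rpow_neg ha0.le
  have hγ_succ : ∀ t : ℕ, (1 - a / ((t : ℝ) + 3)) * γ t ≤ γ (t + 1) := fun t ↦ by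
    have h := Real.one_sub_div_mul_rpow_neg_le ha0.le (by linarith) (hs t)
    simp only [hγ]
    push_cast
    rwa [add_right_comm]
  -- The complementary factor in `α = γ β`; its squares are summable since `2 (ν - a) > 1`.
  set β : ℕ → ℝ := fun t ↦ Cα * ((t : ℝ) + 3) ^ (-(ν - a)) with hβ
  have hγβ : ∀ t, γ t * β t = α t := fun t ↦ by
    rw [hα', hβ, hγ]
    simp only
    rw [mul_left_comm, ← Real.rpow_add (hs t)]
    congr 2
    ring
  have hαβ : ∀ t, α t ≤ β t := fun t ↦ by
    rw [← hγβ]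
    exact mul_le_of_le_one_left (mul_nonneg hCα.le (Real.rpow_nonneg (hs t).le _)) (hγ1 t)
  have hβ_anti : Antitone β := (antitone_natCast_add_three_rpow_neg (by linarith)).const_mul hCα.le
  have hβ_zero : Tendsto β atTop (𝓝 0) := by
    rw [← mul_zero Cα]
    exact (tendsto_natCast_add_three_rpow_neg (by linarith)).const_mul Cα
  have hβ_sq : Summable fun t ↦ β t ^ 2 := by
    have h1 : Summable fun t : ℕ ↦ ((t : ℝ) + 3) ^ (-(ν - a) * 2) := by
      have h2 := (summable_nat_add_iff 3).2 (Real.summable_nat_rpow (p := -(ν - a) * 2) |>.2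
        (by linarith))
      simpa using h2
    refine (h1.mul_left (Cα ^ 2)).congr fun t ↦ ?_
    rw [hβ]
    simp only
    rw [mul_pow, Real.rpow_mul (hs t).le, Real.rpow_two]
  set G : ℕ → Ω → ℝ := fun t ω ↦ runningMax (fun s ↦ ‖w s ω‖) t with hG
  have hG_succ : ∀ t ω, G (t + 1) ω = max (G t ω) ‖w (t + 1) ω‖ := fun _ _ ↦ rfl
  have hG_one : ∀ t ω, 1 ≤ G t ω := fun t ω ↦ one_le_runningMax _ _
  have hwG : ∀ t ω, ‖w t ω‖ ≤ G t ω := fun t ω ↦ le_runningMax (fun s ↦ ‖w s ω‖) t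
  have hH_unc : Measurable (Function.uncurry H) :=
    measurable_uncurry_of_continuous_of_measurable (fun y ↦ (LipschitzWith.of_dist_le' (K := L)
      fun v v' ↦ by rw [dist_eq_norm, dist_eq_norm]; exact hH_lip v v' y).continuous) hH_meas
  have hw_meas : ∀ t, Measurable[𝓕 t] (w t) := fun t ↦ by
    induction t with
    | zero => exact hw_zero
    | succ t ih =>
      have ih' : Measurable[𝓕 (t + 1)] (w t) := ih.mono (𝓕.mono t.le_succ) le_rfl
      rw [funext (hw_succ t)]
      exact ih'.add (((hH_unc.comp (ih'.prodMk (hY.adapted (t + 1)))).sub ih').const_smul (α t))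
  have hG_meas : ∀ t, Measurable[𝓕 t] (G t) := fun t ↦ by
    induction t with
    | zero => exact measurable_const.max (measurable_norm.comp hw_zero)
    | succ t ih =>
      rw [funext (hG_succ t)]
      exact (ih.mono (𝓕.mono t.le_succ) le_rfl).max (measurable_norm.comp (hw_meas (t + 1)))
  have hG_mono : ∀ t ω, G t ω ≤ G (t + 1) ω := fun t ω ↦ le_max_left _ _
  -- From `‖H w y - w‖ ≤ L ‖w‖ + B + ‖w‖`, using `‖w‖ ≤ G` and `1 ≤ G`.
  set C := L + B + 1 with hC
  have hC0 : 0 ≤ C := by positivity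
  have hw_step : ∀ t ω, ‖w (t + 1) ω - w t ω‖ ≤ C * α t * G t ω := fun t ω ↦ by
    rw [hw_succ, add_sub_cancel_left, norm_smul, Real.norm_of_nonneg (hα0 t), mul_comm C,
      mul_assoc]
    refine mul_le_mul_of_nonneg_left ?_ (hα0 t)
    have h1 := hH_lip (w t ω) 0 (Y (t + 1) ω)
    rw [sub_zero] at h1
    have h2 := norm_add_le (H (w t ω) (Y (t + 1) ω) - H 0 (Y (t + 1) ω)) (H 0 (Y (t + 1) ω))
    rw [sub_add_cancel] at h2
    have h3 := norm_sub_le (H (w t ω) (Y (t + 1) ω)) (w t ω)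
    have h4 := mul_le_mul_of_nonneg_left (hwG t ω) hL
    have h5 := mul_le_mul_of_nonneg_left (hG_one t ω) hB
    have h6 := hH_zero (Y (t + 1) ω)
    have h7 := hwG t ω
    rw [hC]
    linarith
  have hG_step : ∀ t ω, G (t + 1) ω - G t ω ≤ C * α t * G t ω := fun t ω ↦ by
    have hG0 : 0 ≤ G t ω := zero_le_one.trans (hG_one t ω)
    have h1 : 0 ≤ C * α t * G t ω := mul_nonneg (mul_nonneg hC0 (hα0 t)) hG0
    have h2 := norm_add_le (w (t + 1) ω - w t ω) (w t ω)
    rw [sub_add_cancel] at h2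
    rw [sub_le_iff_le_add, hG_succ]
    exact max_le (by linarith) (by linarith [hw_step t ω, hwG t ω])
  filter_upwards [ae_exists_tendsto_sum_smul_noise hP hY hH_meas hH_lip hH_zero hw_meas hG_meas
    hG_one hwG hG_mono hG_step hw_step hC0 hα0 hαβ hβ_anti hβ_zero hβ_sq] with ω ⟨l, hl⟩
  set S : ℕ → E := fun n ↦ ∑ k ∈ Finset.range n, β k • ((G k ω)⁻¹ •
      (H (w k ω) (Y (k + 1) ω) - meanOperator H d (w k ω))) with hS
  have hR : Tendsto (fun n ↦ l - S n) atTop (𝓝 0) := by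
    simpa using hl.const_sub l
  set g : ℕ → ℝ := fun t ↦ γ t * G t ω with hg
  have hGpos : ∀ t, 0 < G t ω := fun t ↦ one_pos.trans_le (hG_one t ω)
  have hg0 : ∀ t, 0 ≤ g t := fun t ↦ mul_nonneg (hγ0 t).le (hGpos t).le
  have hgG : ∀ t, g t ≤ G t ω := fun t ↦ mul_le_of_le_one_left (hGpos t).le (hγ1 t)
  have hw : ∀ t, w (t + 1) ω = w t ω + α t • (meanOperator H d (w t ω) - w t ω)
      + g t • ((l - S t) - (l - S (t + 1))) := fun t ↦ by
    have h1 : (l - S t) - (l - S (t + 1)) = β t • ((G t ω)⁻¹ •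
        (H (w t ω) (Y (t + 1) ω) - meanOperator H d (w t ω))) := by
      rw [sub_sub_sub_cancel_left, hS]
      simp only
      rw [Finset.sum_range_succ, add_sub_cancel_left]
    have h2 : g t * β t * (G t ω)⁻¹ = α t := by
      rw [← hγβ, hg]
      have := (hGpos t).ne'
      field_simp
    rw [h1, smul_smul, smul_smul, h2, hw_succ]
    module
  have hinv : ∀ t : ℕ, a / ((t : ℝ) + 3) ≤ Cα⁻¹ * α t := fun t ↦ by
    rw [hα', inv_mul_cancel_left₀ hCα.ne', div_eq_mul_inv, ← Real.rpow_neg_one]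
    calc a * ((t : ℝ) + 3) ^ (-1 : ℝ) ≤ 1 * ((t : ℝ) + 3) ^ (-1 : ℝ) :=
          mul_le_mul_of_nonneg_right (by linarith) (Real.rpow_nonneg (hs t).le _)
      _ ≤ ((t : ℝ) + 3) ^ (-ν) := by
          rw [one_mul]
          exact Real.rpow_le_rpow_of_exponent_le (hs1 t) (by linarith)
  -- The growth of `G` contributes `C`; the decay of `γ`, of relative size `a / (t + 3)`,
  -- contributes `Cα⁻¹` because `ν ≤ 1`.
  have hg_step : ∀ t, |g (t + 1) - g t| ≤ (C + Cα⁻¹) * α t * g t := fun t ↦ by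
    have h1 : g (t + 1) - g t = γ (t + 1) * (G (t + 1) ω - G t ω) - (γ t - γ (t + 1)) * G t ω := by
      rw [hg]; ring
    have h2 : γ (t + 1) ≤ γ t := hγ_anti t.le_succ
    have h3 : γ (t + 1) * (G (t + 1) ω - G t ω) ≤ γ t * (C * α t * G t ω) :=
      mul_le_mul h2 (hG_step t ω) (sub_nonneg.2 (hG_mono t ω)) (hγ0 t).le
    have h4 : 0 ≤ γ (t + 1) * (G (t + 1) ω - G t ω) :=
      mul_nonneg (hγ0 _).le (sub_nonneg.2 (hG_mono t ω))
    have h5 : γ t - γ (t + 1) ≤ Cα⁻¹ * α t * γ t := by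
      have := mul_le_mul_of_nonneg_right (hinv t) (hγ0 t).le
      linarith [hγ_succ t]
    have h6 := mul_le_mul_of_nonneg_right h5 (hGpos t).le
    have h7 := mul_nonneg (sub_nonneg.2 h2) (hGpos t).le
    rw [h1, abs_le, hg]
    constructor <;> nlinarith
  have hC' : 0 ≤ C + Cα⁻¹ := by positivity
  have hα1 : ∀ᶠ t in atTop, α t ≤ 1 := hα_lim.eventually_le_const one_pos
  have hh : ∀ v, ‖meanOperator H d v‖ ≤ κ * ‖v‖ + ‖meanOperator H d 0‖ := fun v ↦ by
    have h1 := hH_contr v 0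
    have h2 := norm_add_le (meanOperator H d v - meanOperator H d 0) (meanOperator H d 0)
    rw [sub_add_cancel] at h2
    rw [sub_zero] at h1
    linarith
  obtain ⟨K, hK⟩ := exists_runningMax_le (w := fun t ↦ w t ω) (G := fun t ↦ G t ω) hκ1 hh hκ0 hC'
    hw hα0 hα1 (fun t ↦ hwG t ω) (fun t ↦ hG_succ t ω) hg0 hgG hg_step hR
  refine exists_eventually_norm_sub_le (w := fun t ↦ w t ω) (γ := γ) (K := K) hκ1 (fun u ↦ ?_) hκ0
    hC' hw hα0 hα1 hg0 (fun t ↦ ?_) hγ0 ?_ hg_step hR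
  · simpa only [hwstar] using hH_contr u wstar
  · rw [hg, mul_comm K]
    exact mul_le_mul_of_nonneg_left (hK t) (hγ0 t).le
  · filter_upwards [haα] with t ht
    exact le_trans (mul_le_mul_of_nonneg_right (by linarith) (hγ0 t).le) (hγ_succ t)

lemma tendsto_rpow_mul_natCast_add_three_rpow_sq {ζ a : ℝ} (hζ : 0 ≤ ζ) (hζa : ζ < 2 * a) :
    Tendsto (fun t : ℕ ↦ (t : ℝ) ^ ζ * (((t : ℝ) + 3) ^ (-a)) ^ 2) atTop (𝓝 0) := by
  refine squeeze_zero (fun t ↦ by positivity) (fun t ↦ ?_)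
    (tendsto_natCast_add_three_rpow_neg (p := 2 * a - ζ) (by linarith))
  have hs : (0 : ℝ) < t + 3 := by positivity
  calc (t : ℝ) ^ ζ * (((t : ℝ) + 3) ^ (-a)) ^ 2
      ≤ ((t : ℝ) + 3) ^ ζ * (((t : ℝ) + 3) ^ (-a)) ^ 2 := by
        gcongr
        linarith
    _ = ((t : ℝ) + 3) ^ (-(2 * a - ζ)) := by
        rw [← Real.rpow_two, ← Real.rpow_mul hs.le, ← Real.rpow_add hs]
        congr 1
        ring

/-- As `θ < 1`, `(log t)^θ ≤ a log t` eventually, so the exponential is at most `t^a`, against a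
decay of `t^(-2a)`. -/
lemma tendsto_exp_log_rpow_mul_natCast_add_three_rpow_sq {ζ θ a : ℝ} (hζ : ζ ≤ 1) (hθ : θ < 1)
    (ha : 0 < a) :
    Tendsto (fun t : ℕ ↦ Real.exp (ζ * Real.log t ^ θ) * (((t : ℝ) + 3) ^ (-a)) ^ 2)
      atTop (𝓝 0) := by
  have hlim : Tendsto (fun t : ℕ ↦ ((t : ℝ)) ^ (-a)) atTop (𝓝 0) :=
    (tendsto_rpow_neg_atTop ha).comp tendsto_natCast_atTop_atTop
  have hlog : Tendsto (fun t : ℕ ↦ Real.log t) atTop atTop :=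
    Real.tendsto_log_atTop.comp tendsto_natCast_atTop_atTop
  have hsmall : Tendsto (fun t : ℕ ↦ Real.log t ^ (-(1 - θ))) atTop (𝓝 0) :=
    (tendsto_rpow_neg_atTop (by linarith)).comp hlog
  refine squeeze_zero' (.of_forall fun t ↦ by positivity) ?_ hlim
  filter_upwards [hsmall.eventually_le_const ha, hlog.eventually_gt_atTop 0,
    eventually_gt_atTop 0] with t h1 h2 h3
  have ht : (0 : ℝ) < t := by exact_mod_cast h3
  have h4 : Real.log t ^ θ ≤ a * Real.log t := by
    have : Real.log t ^ θ = Real.log t ^ (-(1 - θ)) * Real.log t := by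
      rw [← Real.rpow_add_one h2.ne']
      congr 1
      ring
    rw [this]
    exact mul_le_mul_of_nonneg_right h1 h2.le
  have h5 : ζ * Real.log t ^ θ ≤ a * Real.log t :=
    (mul_le_of_le_one_left (Real.rpow_nonneg h2.le _) hζ).trans h4
  have h6 : ((t : ℝ) + 3) ^ (-a) ≤ (t : ℝ) ^ (-a) :=
    Real.rpow_le_rpow_of_nonpos ht (by linarith) (by linarith)
  calc Real.exp (ζ * Real.log t ^ θ) * (((t : ℝ) + 3) ^ (-a)) ^ 2
      ≤ Real.exp (a * Real.log t) * ((t : ℝ) ^ (-a)) ^ 2 := by gcongr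
    _ = (t : ℝ) ^ (-a) := by
        rw [← mul_comm (Real.log _), ← Real.rpow_def_of_pos ht, sq, ← mul_assoc,
          ← Real.rpow_add ht, add_neg_cancel, Real.rpow_zero, one_mul]

theorem theorem1
    -- `E` is `ℝ^d` endowed with an arbitrary norm
    {E : Type*} [NormedAddCommGroup E] [NormedSpace ℝ E] [FiniteDimensional ℝ E]
    [MeasurableSpace E] [BorelSpace E]
    {Ω : Type*} {mΩ : MeasurableSpace Ω} (μ : Measure Ω) [IsProbabilityMeasure μ]
    {𝒴 : Type*} [MeasurableSpace 𝒴]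
    -- the noise: a geometrically mixing Markov chain
    (P : Kernel 𝒴 𝒴) [IsMarkovKernel P] (d : Measure 𝒴) [IsProbabilityMeasure d]
    (hP : GeometricallyMixing P d)
    (𝓕 : Filtration ℕ mΩ) (Y : ℕ → Ω → 𝒴) (hY : IsMarkovChain P 𝓕 Y μ)
    -- the update function and its average
    (H : E → 𝒴 → E) (hH_meas : ∀ w, Measurable (H w))
    (hH_contr : ∃ κ : ℝ, 0 ≤ κ ∧ κ < 1 ∧
      ∀ w w', ‖meanOperator H d w - meanOperator H d w'‖ ≤ κ * ‖w - w'‖)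
    (hH_lip : ∃ L : ℝ, ∀ w w' y, ‖H w y - H w' y‖ ≤ L * ‖w - w'‖)
    (hH_bdd : BddAbove (Set.range fun y ↦ ‖H 0 y‖))
    -- the learning rates
    (Cα ν : ℝ) (hCα : 0 < Cα) (hν : ν ∈ Set.Ioc (2 / 3 : ℝ) 1)
    (α : ℕ → ℝ) (hα : ∀ t : ℕ, α t = Cα / ((t : ℝ) + 3) ^ ν)
    -- the iterates
    (w : ℕ → Ω → E) (hw_zero : Measurable[𝓕 0] (w 0))
    (hw_succ : ∀ t ω, w (t + 1) ω = w t ω + α t • (H (w t ω) (Y (t + 1) ω) - w t ω)) :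
    ∃ wstar : E,
      (∀ v, meanOperator H d v = v ↔ v = wstar) ∧
      (ν < 1 → ∀ ζ ∈ Set.Ioo (0 : ℝ) (3 / 2 * ν - 1), ∀ᵐ ω ∂μ,
        Tendsto (fun t : ℕ ↦ (t : ℝ) ^ ζ * ‖w t ω - wstar‖ ^ 2) atTop (𝓝 0)) ∧
      (ν = 1 → ∀ ζ ∈ Set.Ioo (0 : ℝ) 1, ∀ ν₁ : ℝ, 0 < ν₁ → ∀ᵐ ω ∂μ,
        Tendsto (fun t : ℕ ↦ Real.exp (ζ * (Real.log t) ^ (1 / (1 + ν₁))) * ‖w t ω - wstar‖ ^ 2)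
          atTop (𝓝 0)) := by
  obtain ⟨κ, hκ0, hκ1, hκ⟩ := hH_contr
  obtain ⟨L, hL⟩ := hH_lip
  obtain ⟨B, hB⟩ := hH_bdd
  have hL' : ∀ v v' y, ‖H v y - H v' y‖ ≤ max L 0 * ‖v - v'‖ := fun v v' y ↦
    (hL v v' y).trans (by gcongr; exact le_max_left _ _)
  have hB' : ∀ y, ‖H 0 y‖ ≤ max B 0 := fun y ↦ (hB ⟨y, rfl⟩).trans (le_max_left _ _)
  have := FiniteDimensional.complete ℝ E
  obtain ⟨wstar, hwstar⟩ := exists_forall_eq_iff_eq_of_contraction hκ0 hκ1 hκ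
  have hκ' : 0 < 1 - κ := by linarith
  have hrate : ∀ a : ℝ, 0 < a → a < ν - 1 / 2 →
      (∀ᶠ t : ℕ in atTop, a / ((t : ℝ) + 3) ≤ (1 - κ) / 2 * α t) →
      ∀ᵐ ω ∂μ, ∃ D, ∀ᶠ t : ℕ in atTop, ‖w t ω - wstar‖ ≤ D * ((t : ℝ) + 3) ^ (-a) :=
    fun a ha0 haν haα ↦ ae_exists_eventually_norm_sub_le_rpow hP hY hH_meas hκ0 hκ1 hκ
      (le_max_right _ _) (le_max_right _ _) hL' hB' hCα hν.2 ha0 haν hα haα hw_zero hw_succ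
      ((hwstar wstar).2 rfl)
  refine ⟨wstar, hwstar, fun hν1 ζ hζ ↦ ?_, fun hν1 ζ hζ ν₁ hν₁ ↦ ?_⟩
  · obtain ⟨hζ0, hζ1⟩ := hζ
    obtain ⟨a, haζ, haν⟩ := exists_between (show ζ / 2 < ν - 1 / 2 by linarith [hν.1])
    have ha0 : 0 < a := by linarith
    -- Since `ν < 1`, the step size eventually dominates any multiple of `1 / t`, so the contraction
    -- puts no limit on `a`.
    have hev : ∀ᶠ t : ℕ in atTop, a / ((t : ℝ) + 3) ≤ (1 - κ) / 2 * α t := by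
      have hpos : 0 < (1 - κ) / 2 * Cα / a := by positivity
      filter_upwards [(tendsto_natCast_add_three_rpow_neg
        (sub_pos.2 hν1)).eventually_le_const hpos] with t ht
      have hs : (0 : ℝ) < t + 3 := by positivity
      have hsν := Real.rpow_pos_of_pos hs ν
      rw [le_div_iff₀ ha0, neg_sub, Real.rpow_sub_one hs.ne', div_mul_eq_mul_div,
        div_le_iff₀ hs] at ht
      rw [hα, mul_div_assoc', div_le_div_iff₀ hs hsν]
      linarith
    filter_upwards [hrate a ha0 haν hev] with ω ⟨D, hD⟩
    exact tendsto_mul_norm_sq_of_eventually_le hD (fun t ↦ by positivity)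
      (tendsto_rpow_mul_natCast_add_three_rpow_sq hζ0.le (by linarith))
  -- Now `α` is itself of order `1 / t`, so `a` is capped by the contraction gap times `Cα`; `1 / 4`
  -- keeps it below `ν - 1/2 = 1/2`.
  · set a := min ((1 - κ) / 2 * Cα) (1 / 4) with ha
    have ha0 : 0 < a := lt_min (by positivity) (by norm_num)
    have hev : ∀ᶠ t : ℕ in atTop, a / ((t : ℝ) + 3) ≤ (1 - κ) / 2 * α t := .of_forall fun t ↦ by
      rw [hα, hν1, Real.rpow_one, mul_div_assoc']
      gcongr
      exact min_le_left _ _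
    have ha1 : a ≤ 1 / 4 := min_le_right _ _
    filter_upwards [hrate a ha0 (by linarith) hev] with ω ⟨D, hD⟩
    refine tendsto_mul_norm_sq_of_eventually_le hD (fun t ↦ by positivity)
      (tendsto_exp_log_rpow_mul_natCast_add_three_rpow_sq hζ.2.le ?_ ha0)
    rw [div_lt_one (by linarith)]
    linarith
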